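/- Let $\Gamma=(0,\infty)$ be the multiplicative group of positive reals, and let $a\to 0$ denote convergence along the filter generated by the intervals $(0,r)$, $r>0$. An emergent algebra over $\Gamma$ is a separated (Hausdorff) uniform space $X$ with two families of binary operations $\circ_a,\bullet_a$ on $X$ ($a\in\Gamma$), each $\circ_a : X\times X\to X$ continuous, such that for all $a,b\in\Gamma$ and $x,y\in X$: (R1) $x\circ_a x=x$; (R2) $x\circ_a(x\bullet_a y)=x\bullet_a(x\circ_a y)=y$; (act) $x\circ_a(x\circ_b y)=x\circ_{ab}y$, $\;x\circ_1 y=y$, $\;x\circ_{1/a}y=x\bullet_a y$; (em) as $a\to 0$, uniformly on compact sets, $(x,y)\mapsto x\circ_a y$ converges to $(x,y)\mapsto x$, and the maps $(x,y,z)\mapsto (x\circ_a y)\bullet_a(x\circ_a z)$ and $(x,y,z)\mapsto x\bullet_a((x\circ_a y)\circ_a z)$ each converge to some function $X^3\to X$. Theorem 3. Let $X$ be an emergent algebra over $\Gamma=(0,\infty)$. If its operations are right distributive, $$\text{(COLIN)}\qquad (x\circ_a y)\circ_b z=(x\circ_b z)\circ_a(y\circ_b z)\quad\text{for all } a,b\in\Gamma,\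 x,y,z\in X,$$ then they are left distributive, $$\text{(LIN)}\qquad x\circ_a(y\circ_b z)=(x\circ_a y)\circ_b(x\circ_a z)\quad\text{for all } a,b\in\Gamma,\ x,y,z\in X.$$ -/

import Mathlib

open Filter Topology Uniformity

/-- An absolute on a commutative group: a proper filter invariant under multiplication
by every element of the group. -/
structure Absolute (Γ : Type*) [CommGroup Γ] where
  filter : Filter Γ
  neBot : filter.NeBot
  map_mul : ∀ b : Γ, Filter.map (fun a => b * a) filter = filter

/-- The multiplicative group `(0, ∞)` of positive real numbers. -/
abbrev PosReals : Type := {a : ℝ // 0 < a}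

/-- The filter on `(0, ∞)` generated by the intervals `(0, r)`, `r > 0`. -/
def zeroFilter : Filter PosReals := ⨅ r : PosReals, 𝓟 {a : PosReals | a < r}

theorem mem_zeroFilter (s : Set PosReals) :
    s ∈ zeroFilter ↔ ∃ r : PosReals, {a : PosReals | a < r} ⊆ s := by
  have hd : Directed (· ≥ ·) (fun r : PosReals => 𝓟 {a : PosReals | a < r}) := by
    intro r s
    refine ⟨min r s, ?_, ?_⟩
    · simp only [ge_iff_le, le_principal_iff, mem_principal]
      exact fun a ha => lt_of_lt_of_le ha (min_le_left r s)
    · simp only [ge_iff_le, le_principal_iff, mem_principal]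
      exact fun a ha => lt_of_lt_of_le ha (min_le_right r s)
  have : Nonempty PosReals := ⟨⟨1, one_pos⟩⟩
  unfold zeroFilter
  rw [mem_iInf_of_directed hd]
  simp only [mem_principal]

/-- The absolute `0` of the group `(0, ∞)`. -/
def zeroAbsolute : Absolute PosReals where
  filter := zeroFilter
  neBot := by
    refine ⟨fun h => ?_⟩
    have h' : (∅ : Set PosReals) ∈ zeroFilter := by rw [h]; exact mem_bot
    obtain ⟨r, hr⟩ := (mem_zeroFilter _).1 h'
    have hpos : 0 < (r : ℝ) / 2 := half_pos r.2
    have hlt : (⟨(r : ℝ) / 2, hpos⟩ : PosReals) < r := Subtype.coe_lt_coe.1 (half_lt_self r.2)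
    exact hr hlt
  map_mul := by
    intro b
    ext s
    rw [mem_map, mem_zeroFilter, mem_zeroFilter]
    constructor
    · rintro ⟨r, hr⟩
      refine ⟨b * r, fun a ha => ?_⟩
      have h1 : b⁻¹ * a < r := by
        have h2 : a < b * r := ha
        exact inv_mul_lt_iff_lt_mul.2 h2
      have h3 := hr h1
      simpa using h3
    · rintro ⟨r, hr⟩
      refine ⟨b⁻¹ * r, fun a ha => hr ?_⟩
      have h2 : a < b⁻¹ * r := ha
      exact lt_inv_mul_iff_mul_lt.1 h2

/-- An emergent algebra over a (separated) uniform space `X`, with scalars in a commutative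
group `Γ` endowed with an absolute `μ`.  `circ a x y` is `x ∘ₐ y` and `bullet a x y` is `x •ₐ y`. -/
structure EmergentAlgebra (Γ : Type*) [CommGroup Γ] (μ : Absolute Γ)
    (X : Type*) [UniformSpace X] [T2Space X] where
  circ : Γ → X → X → X
  bullet : Γ → X → X → X
  /-- (R1) -/
  circ_self : ∀ a x, circ a x x = x
  /-- (R2) -/
  circ_bullet : ∀ a x y, circ a x (bullet a x y) = y
  bullet_circ : ∀ a x y, bullet a x (circ a x y) = y
  /-- (act) -/
  circ_circ : ∀ a b x y, circ a x (circ b x y) = circ (a * b) x y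
  circ_one : ∀ x y, circ 1 x y = y
  circ_inv : ∀ a x y, circ a⁻¹ x y = bullet a x y
  /-- Each operation is (jointly) continuous. -/
  continuous_circ : ∀ a, Continuous fun p : X × X => circ a p.1 p.2
  /-- (em): `x ∘ₐ y` converges to `x`, uniformly on compact sets. -/
  tendsto_circ : ∀ K : Set (X × X), IsCompact K →
    TendstoUniformlyOn (fun a (p : X × X) => circ a p.1 p.2) (fun p => p.1) μ.filter K
  /-- (em): the approximate difference `(x ∘ₐ y) •ₐ (x ∘ₐ z)` converges to some function of
  `(x, y, z)`, uniformly on compact sets. -/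
  tendsto_difference : ∃ D : X × X × X → X, ∀ K : Set (X × X × X), IsCompact K →
    TendstoUniformlyOn
      (fun a (p : X × X × X) => bullet a (circ a p.1 p.2.1) (circ a p.1 p.2.2)) D μ.filter K
  /-- (em): the approximate sum `x •ₐ ((x ∘ₐ y) ∘ₐ z)` converges to some function of
  `(x, y, z)`, uniformly on compact sets. -/
  tendsto_sum : ∃ S : X × X × X → X, ∀ K : Set (X × X × X), IsCompact K →
    TendstoUniformlyOn
      (fun a (p : X × X × X) => bullet a p.1 (circ a (circ a p.1 p.2.1) p.2.2)) S μ.filter K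

namespace EmergentAlgebra

/-- (LIN): the operations are left distributive. -/
def LIN {Γ : Type*} [CommGroup Γ] {μ : Absolute Γ} {X : Type*} [UniformSpace X] [T2Space X]
    (A : EmergentAlgebra Γ μ X) : Prop :=
  ∀ (a b : Γ) (x y z : X),
    A.circ a x (A.circ b y z) = A.circ b (A.circ a x y) (A.circ a x z)

/-- (COLIN): the operations are right distributive. -/
def COLIN {Γ : Type*} [CommGroup Γ] {μ : Absolute Γ} {X : Type*} [UniformSpace X] [T2Space X]
    (A : EmergentAlgebra Γ μ X) : Prop :=
  ∀ (a b : Γ) (x y z : X),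
    A.circ b (A.circ a x y) z = A.circ a (A.circ b x z) (A.circ b y z)

end EmergentAlgebra

/-!
Fix a base point `e` and write `b · x` for `e ∘_b x`. The limit `S` of the approximate sums and the
limit `D` of the approximate differences make `X` a group with neutral element `e`, on which the
dilations `x ↦ b · x` act by automorphisms; `D e u v` is `v - u`. Right distributivity has three
consequences.

* The group is commutative (`S_comm`), since the approximate sum of `y` and `z` is exactly the
  approximate sum of `z` and `y ∘_a z`, and `y ∘_a z → y`.
* `x ∘_b e = x - b · x` (`circ_base_eq_D`): for every `a`, `x ∘_b (a · x)` is the approximate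
  difference `Δ_a` of `b · x` and `x`.
* The map `R_b : x ↦ x ∘_b e` is an endomorphism of every operation `∘_c`; this is (COLIN) itself.

By the second point `R_b` is `1 - b`, which is injective for `b ≠ 1` because the powers of `b`
or of `b⁻¹` contract `X` to `e` (`circ_base_injective`). Now `1 - b = (1 - b⁻¹)(-b)`, that is,
`R_b = R_{b⁻¹} ∘ (-b)`, so injectivity shows that `-b` is an endomorphism of every `∘_c` too
(`neg_dilation_circ`). The square of `-b` is the dilation of ratio `b²`, and every positive real
is a square, so every dilation is an endomorphism of every `∘_c`, which is (LIN).
-/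

/-- If continuous functions converge uniformly on compact sets along a countably generated filter,
they converge continuously: arguments may vary with the index. No local compactness is needed,
because a convergent sequence together with its limit is compact. -/
theorem tendsto_diagonal_of_tendstoUniformlyOn_isCompact {ι P X : Type*} [TopologicalSpace P]
    [UniformSpace X] {l : Filter ι} [l.IsCountablyGenerated] {F : ι → P → X} {G : P → X}
    (hF : ∀ i, Continuous (F i)) (hK : ∀ K : Set P, IsCompact K → TendstoUniformlyOn F G l K)
    {p : ι → P} {q : P} (hp : Tendsto p l (𝓝 q)) :
    Tendsto (fun i => F i (p i)) l (𝓝 (G q)) := by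
  refine tendsto_of_seq_tendsto fun s hs => ?_
  have hps : Tendsto (fun n => p (s n)) atTop (𝓝 q) := hp.comp hs
  set K : Set P := insert q (Set.range fun n => p (s n))
  have hu : TendstoUniformlyOn (fun n => F (s n)) G atTop K :=
    fun u hu => hs.eventually (hK K hps.isCompact_insert_range u hu)
  have hG : ContinuousOn G K :=
    hu.continuousOn (Frequently.of_forall fun n => (hF (s n)).continuousOn)
  refine hu.tendsto_comp (hG q (Set.mem_insert _ _)) ?_
  exact tendsto_nhdsWithin_iff.2
    ⟨hps, Eventually.of_forall fun n => Set.mem_insert_of_mem _ ⟨n, rfl⟩⟩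

theorem zeroFilter_eq_comap : zeroFilter = comap Subtype.val (𝓝 (0 : ℝ)) := by
  ext s
  rw [mem_zeroFilter, mem_comap]
  constructor
  · rintro ⟨r, hr⟩
    exact ⟨Set.Iio r, Iio_mem_nhds r.2, fun a ha => hr ha⟩
  · rintro ⟨t, ht, hts⟩
    obtain ⟨ε, hε, hb⟩ := Metric.mem_nhds_iff.1 ht
    refine ⟨⟨ε, hε⟩, fun a ha => hts (hb ?_)⟩
    have ha' : (a : ℝ) < ε := ha
    simpa [abs_of_pos a.2] using ha'

instance : zeroAbsolute.filter.IsCountablyGenerated := by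
  change zeroFilter.IsCountablyGenerated
  rw [zeroFilter_eq_comap]
  infer_instance

instance {Γ : Type*} [CommGroup Γ] (μ : Absolute Γ) : μ.filter.NeBot := μ.neBot

namespace EmergentAlgebra

section Tangent

variable {Γ : Type*} [CommGroup Γ] {μ : Absolute Γ} {X : Type*} [UniformSpace X] [T2Space X]
  (A : EmergentAlgebra Γ μ X)

/-- The limit of the approximate differences `(x ∘_a y) •_a (x ∘_a z)`. -/
noncomputable def D (x y z : X) : X := A.tendsto_difference.choose (x, y, z)

/-- The limit of the approximate sums `x •_a ((x ∘_a y) ∘_a z)`. -/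
noncomputable def S (x y z : X) : X := A.tendsto_sum.choose (x, y, z)

theorem continuous_circ_comp {P : Type*} [TopologicalSpace P] (a : Γ) {f g : P → X}
    (hf : Continuous f) (hg : Continuous g) : Continuous fun p => A.circ a (f p) (g p) :=
  (A.continuous_circ a).comp (hf.prodMk hg)

theorem continuous_bullet_comp {P : Type*} [TopologicalSpace P] (a : Γ) {f g : P → X}
    (hf : Continuous f) (hg : Continuous g) : Continuous fun p => A.bullet a (f p) (g p) := by
  simp only [← A.circ_inv]
  exact A.continuous_circ_comp a⁻¹ hf hg

variable [μ.filter.IsCountablyGenerated]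

theorem tendsto_circ_diagonal {x y : Γ → X} {x₀ y₀ : X} (hx : Tendsto x μ.filter (𝓝 x₀))
    (hy : Tendsto y μ.filter (𝓝 y₀)) :
    Tendsto (fun a => A.circ a (x a) (y a)) μ.filter (𝓝 x₀) :=
  tendsto_diagonal_of_tendstoUniformlyOn_isCompact A.continuous_circ A.tendsto_circ
    (hx.prodMk_nhds hy)

theorem tendsto_D {x y z : Γ → X} {x₀ y₀ z₀ : X} (hx : Tendsto x μ.filter (𝓝 x₀))
    (hy : Tendsto y μ.filter (𝓝 y₀)) (hz : Tendsto z μ.filter (𝓝 z₀)) :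
    Tendsto (fun a => A.bullet a (A.circ a (x a) (y a)) (A.circ a (x a) (z a))) μ.filter
      (𝓝 (A.D x₀ y₀ z₀)) :=
  tendsto_diagonal_of_tendstoUniformlyOn_isCompact
    (F := fun a (p : X × X × X) => A.bullet a (A.circ a p.1 p.2.1) (A.circ a p.1 p.2.2))
    (fun a => A.continuous_bullet_comp a
      (A.continuous_circ_comp a continuous_fst (by fun_prop))
      (A.continuous_circ_comp a continuous_fst (by fun_prop)))
    A.tendsto_difference.choose_spec (hx.prodMk_nhds (hy.prodMk_nhds hz))

theorem tendsto_S {x y z : Γ → X} {x₀ y₀ z₀ : X} (hx : Tendsto x μ.filter (𝓝 x₀))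
    (hy : Tendsto y μ.filter (𝓝 y₀)) (hz : Tendsto z μ.filter (𝓝 z₀)) :
    Tendsto (fun a => A.bullet a (x a) (A.circ a (A.circ a (x a) (y a)) (z a))) μ.filter
      (𝓝 (A.S x₀ y₀ z₀)) :=
  tendsto_diagonal_of_tendstoUniformlyOn_isCompact
    (F := fun a (p : X × X × X) => A.bullet a p.1 (A.circ a (A.circ a p.1 p.2.1) p.2.2))
    (fun a => A.continuous_bullet_comp a continuous_fst
      (A.continuous_circ_comp a
        (A.continuous_circ_comp a continuous_fst (by fun_prop)) (by fun_prop)))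
    A.tendsto_sum.choose_spec (hx.prodMk_nhds (hy.prodMk_nhds hz))

theorem S_base_left (e v : X) : A.S e e v = v := by
  refine tendsto_nhds_unique
    (A.tendsto_S (tendsto_const_nhds (x := e)) (tendsto_const_nhds (x := e))
      (tendsto_const_nhds (x := v))) ?_
  simp only [A.circ_self, A.bullet_circ]
  exact tendsto_const_nhds

theorem S_D (e u v : X) : A.S e u (A.D e u v) = v := by
  refine tendsto_nhds_unique
    (A.tendsto_S (tendsto_const_nhds (x := e)) (tendsto_const_nhds (x := u))
      (A.tendsto_D (tendsto_const_nhds (x := e)) (tendsto_const_nhds (x := u))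
        (tendsto_const_nhds (x := v)))) ?_
  simp only [A.circ_bullet, A.bullet_circ]
  exact tendsto_const_nhds

/-- The approximate sums are associative up to moving the base point of the inner sum from `e` to
`e ∘_a u`, and this point tends to `e`. -/
theorem S_assoc (e u v w : X) : A.S e (A.S e u v) w = A.S e u (A.S e v w) := by
  have he := tendsto_const_nhds (x := e) (f := μ.filter)
  have hu := tendsto_const_nhds (x := u) (f := μ.filter)
  have hv := tendsto_const_nhds (x := v) (f := μ.filter)
  have hw := tendsto_const_nhds (x := w) (f := μ.filter)
  refine tendsto_nhds_unique (A.tendsto_S he (A.tendsto_S he hu hv) hw) ?_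
  refine (A.tendsto_S he hu (A.tendsto_S (A.tendsto_circ_diagonal he hu) hv hw)).congr fun a => ?_
  simp only [A.circ_bullet]

theorem S_comm (hA : A.COLIN) (e u v : X) : A.S e u v = A.S e v u := by
  have he := tendsto_const_nhds (x := e) (f := μ.filter)
  have hu := tendsto_const_nhds (x := u) (f := μ.filter)
  have hv := tendsto_const_nhds (x := v) (f := μ.filter)
  refine tendsto_nhds_unique (A.tendsto_S he hu hv) ?_
  refine (A.tendsto_S he hv (A.tendsto_circ_diagonal hu hv)).congr fun a => ?_
  rw [hA a a e u v]

/-- Dilations based at `e` are compatible with the difference operation at `e`. -/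
theorem D_dilation (b : Γ) (e u v : X) :
    A.D e (A.circ b e u) (A.circ b e v) = A.circ b e (A.D e u v) := by
  have he := tendsto_const_nhds (x := e) (f := μ.filter)
  have hu := tendsto_const_nhds (x := u) (f := μ.filter)
  have hv := tendsto_const_nhds (x := v) (f := μ.filter)
  have hb : Tendsto (fun a => b * a) μ.filter μ.filter := (μ.map_mul b).le
  refine tendsto_nhds_unique
    (A.tendsto_D he (tendsto_const_nhds (x := A.circ b e u))
      (tendsto_const_nhds (x := A.circ b e v))) ?_
  have h := ((A.continuous_circ b).tendsto (e, A.D e u v)).comp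
    (((A.tendsto_circ_diagonal he hu).prodMk_nhds (A.tendsto_D he hu hv)).comp hb)
  refine h.congr fun a => ?_
  simp only [Function.comp_apply, ← A.circ_inv, A.circ_circ]
  rw [mul_comm a b, mul_inv, mul_inv_cancel_left]

/-- In the tangent group at `e`, this is the identity `x ∘_b e = x - b · x`. -/
theorem circ_base_eq_D (hA : A.COLIN) (b : Γ) (e x : X) :
    A.circ b x e = A.D e (A.circ b e x) x := by
  have he := tendsto_const_nhds (x := e) (f := μ.filter)
  have hx := tendsto_const_nhds (x := x) (f := μ.filter)
  have h := ((A.continuous_circ b).tendsto (x, e)).comp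
    (hx.prodMk_nhds (A.tendsto_circ_diagonal he hx))
  refine tendsto_nhds_unique h ?_
  refine (A.tendsto_D he (tendsto_const_nhds (x := A.circ b e x)) hx).congr fun a => ?_
  -- (COLIN) for `e, x, e ∘_a x`, whose left-hand side collapses to `e ∘_a x` by idempotence
  have hc := hA a b e x (A.circ a e x)
  rw [A.circ_self, A.circ_circ, mul_comm b a, ← A.circ_circ] at hc
  have h2 := congrArg (A.bullet a (A.circ a e (A.circ b e x))) hc
  rwa [A.bullet_circ] at h2

/-- The tangent group at `e`, an abelian group structure on `X` with zero `e` and addition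
`S e`. -/
@[reducible]
noncomputable def tangentGroup (hA : A.COLIN) (e : X) : AddCommGroup X :=
  letI : Zero X := ⟨e⟩
  letI : Add X := ⟨A.S e⟩
  letI : Neg X := ⟨fun u => A.D e u e⟩
  { AddGroup.ofLeftAxioms (A.S_assoc e) (A.S_base_left e)
      (fun u => (A.S_comm hA e _ u).trans (A.S_D e u e)) with
    add_comm := A.S_comm hA e }

theorem D_eq_sub (hA : A.COLIN) (e u v : X) :
    letI := A.tangentGroup hA e
    A.D e u v = v - u := by
  let := A.tangentGroup hA e
  exact eq_sub_of_add_eq' (A.S_D e u v)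

/-- The dilation `b ·` at `e`, as an endomorphism of the tangent group. -/
noncomputable def dilation (hA : A.COLIN) (b : Γ) (e : X) :
    letI := A.tangentGroup hA e
    X →+ X :=
  letI := A.tangentGroup hA e
  AddMonoidHom.ofMapSub (A.circ b e) fun u v => by
    have h := A.D_dilation b e v u
    rw [A.D_eq_sub hA, A.D_eq_sub hA] at h
    exact h.symm

theorem circ_base_eq_sub (hA : A.COLIN) (b : Γ) (e x : X) :
    letI := A.tangentGroup hA e
    A.circ b x e = x - A.dilation hA b e x :=
  (A.circ_base_eq_D hA b e x).trans (A.D_eq_sub hA e _ x)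

/-- If `e` is the only fixed point of the dilation of ratio `b` at `e`, then `x ↦ x ∘_b e`, which
is `1 - b` in the tangent group, is injective. -/
theorem circ_base_injective (hA : A.COLIN) {b : Γ} {e : X}
    (hfix : ∀ d, A.circ b e d = d → d = e) : Function.Injective fun x => A.circ b x e := by
  let := A.tangentGroup hA e
  intro x y hxy
  have h : x - A.dilation hA b e x = y - A.dilation hA b e y := by
    have h' : A.circ b x e = A.circ b y e := hxy
    rwa [A.circ_base_eq_sub hA b e x, A.circ_base_eq_sub hA b e y] at h'
  refine sub_eq_zero.1 (hfix (x - y) ?_)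
  change A.dilation hA b e (x - y) = x - y
  rw [map_sub, sub_eq_sub_iff_add_eq_add]
  rw [sub_eq_sub_iff_add_eq_add] at h
  rw [add_comm, ← h, add_comm]

/-- In the tangent group, `(1 - b⁻¹)(-b) = 1 - b`. -/
theorem circ_inv_neg_dilation (hA : A.COLIN) (b : Γ) (e x : X) :
    A.circ b⁻¹ (A.D e (A.circ b e x) e) e = A.circ b x e := by
  let := A.tangentGroup hA e
  have hinv : A.dilation hA b⁻¹ e (A.dilation hA b e x) = x := by
    change A.circ b⁻¹ e (A.circ b e x) = x
    rw [A.circ_circ, inv_mul_cancel, A.circ_one]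
  rw [A.circ_base_eq_sub hA b⁻¹ e, A.circ_base_eq_sub hA b e x]
  change -(A.dilation hA b e x) - A.dilation hA b⁻¹ e (-(A.dilation hA b e x))
    = x - A.dilation hA b e x
  rw [map_neg, hinv]
  abel

theorem neg_dilation_circ (hA : A.COLIN) {b : Γ} {e : X}
    (hfix : ∀ d, A.circ b⁻¹ e d = d → d = e) (c : Γ) (x y : X) :
    A.D e (A.circ b e (A.circ c x y)) e =
      A.circ c (A.D e (A.circ b e x) e) (A.D e (A.circ b e y) e) := by
  apply A.circ_base_injective hA hfix
  change A.circ b⁻¹ _ e = A.circ b⁻¹ _ e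
  rw [hA, A.circ_inv_neg_dilation hA, A.circ_inv_neg_dilation hA, A.circ_inv_neg_dilation hA, hA]

theorem neg_dilation_neg_dilation (hA : A.COLIN) (b : Γ) (e x : X) :
    A.D e (A.circ b e (A.D e (A.circ b e x) e)) e = A.circ (b * b) e x := by
  let := A.tangentGroup hA e
  rw [← A.circ_circ]
  change -(A.dilation hA b e (-(A.dilation hA b e x)))
    = A.dilation hA b e (A.dilation hA b e x)
  rw [map_neg, neg_neg]

theorem circ_mul_self_circ (hA : A.COLIN) {b : Γ} {e : X}
    (hfix : ∀ d, A.circ b⁻¹ e d = d → d = e) (c : Γ) (x y : X) :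
    A.circ (b * b) e (A.circ c x y) = A.circ c (A.circ (b * b) e x) (A.circ (b * b) e y) := by
  simp only [← A.neg_dilation_neg_dilation hA]
  rw [A.neg_dilation_circ hA hfix, A.neg_dilation_circ hA hfix]

end Tangent

section PosReals

variable {X : Type*} [UniformSpace X] [T2Space X] (A : EmergentAlgebra PosReals zeroAbsolute X)

theorem eq_base_of_circ_eq_self_of_lt_one {b : PosReals} (hb : b < 1) {e d : X}
    (h : A.circ b e d = d) : d = e := by
  have hpow : ∀ n : ℕ, A.circ (b ^ n) e d = d := by
    intro n
    induction n with
    | zero => rw [pow_zero, A.circ_one]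
    | succ n ih => rw [pow_succ, ← A.circ_circ, h, ih]
  have hlim : Tendsto (fun n : ℕ => b ^ n) atTop zeroAbsolute.filter := by
    change Tendsto _ _ zeroFilter
    rw [zeroFilter_eq_comap, tendsto_comap_iff]
    exact tendsto_pow_atTop_nhds_zero_of_lt_one b.2.le hb
  have ht := (A.tendsto_circ_diagonal (tendsto_const_nhds (x := e))
    (tendsto_const_nhds (x := d))).comp hlim
  exact tendsto_nhds_unique (tendsto_const_nhds.congr fun n => (hpow n).symm) ht

theorem eq_base_of_circ_eq_self {b : PosReals} (hb : b ≠ 1) {e d : X}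
    (h : A.circ b e d = d) : d = e := by
  rcases lt_or_gt_of_ne hb with hlt | hgt
  · exact A.eq_base_of_circ_eq_self_of_lt_one hlt h
  · refine A.eq_base_of_circ_eq_self_of_lt_one (inv_lt_one'.2 hgt) (b := b⁻¹) ?_
    conv_lhs => rw [← h]
    rw [A.circ_circ, inv_mul_cancel, A.circ_one]

end PosReals

end EmergentAlgebra

theorem theorem3 {X : Type*} [UniformSpace X] [T2Space X]
    (A : EmergentAlgebra PosReals zeroAbsolute X) (hA : A.COLIN) : A.LIN := by
  intro a c e x y
  rcases eq_or_ne a 1 with rfl | ha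
  · simp only [A.circ_one]
  obtain ⟨b, rfl⟩ : ∃ b : PosReals, a = b * b :=
    ⟨⟨√a, Real.sqrt_pos.2 a.2⟩, Subtype.ext (Real.mul_self_sqrt a.2.le).symm⟩
  have hb : b⁻¹ ≠ 1 := fun h => ha (by rw [inv_eq_one.1 h, mul_one])
  exact A.circ_mul_self_circ hA (fun d hd => A.eq_base_of_circ_eq_self hb hd) c x y
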